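/- \textbf{Setting.} A Turing machine $M=(Q,\Gamma,\delta,q_0,q_{halt})$ has a finite state set $Q$, tape alphabet $\Gamma=\{0,1,\sqcup,\triangleright\}$ and transition function $\delta:Q\times\Gamma\to Q\times\Gamma\times\{L,S,R\}$, such that $\delta(q,\triangleright)=(p,\triangleright,R)$ for some $p$ whenever $q\ne q_{halt}$; $\triangleright$ is never written on a square not containing it; $\delta(q_{halt},a)=(q_{halt},a,S)$ for all $a\in\Gamma$; and no other state behaves in this way. On input $s\in\{0,1\}^*$ the machine starts in state $q_0$, reading square $0$ of the tape $\triangleright\, s\,\sqcup\sqcup\cdots$. Write $M(s)=v$, $v\in\{0,1\}$, if $M$ reaches $q_{halt}$ while reading square $1$, and that square contains $v$. If $M$ halts on all inputs, $t_M(n)$ is the maximal number of steps that $M$ makes on inputs of length $n$. Formulas are first-order formulas in the language $\{=,\in\}$ with one constant symbol $t$ for the table of a computation; $t_{i,j}=t(i)(j)$ is the triple (symbol, state, flag) of square $j$ at step $i$, the flag being $1$ if the square is being read and $0$ otherwise. $\mathbf T_{\langle M,s\rangle}$ is the finite sequence of formulas consisting of first $\mathbf{def}_M$, which does not depend on $s$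 (it says that $t$ is a table of squares $t_{i,j}\in\Gamma\times Q\times\{0,1\}$, that $t_{i,0}$ always carries $\triangleright$, that exactly one square is read at each step, one formula for each value of $\delta$, and that row $0$ is blank exactly from some square on), and then $\mathbf{input}_s$, consisting, in this order, of $\forall j\,(j>\|s\|\to t_{0,j}=(\sqcup,q_0,0))$, $\ t_{0,0}=(\triangleright,q_0,1)$, and $t_{0,j+1}=(s_j,q_0,0)$ for $j=0,\dots,\|s\|-1$. The algorithm $\mathbf{AL}$ decides membership in a finite sequence of formulas by comparing the given formula with the members one after the other. For a finite theory $T$, a proof $\pi=\langle\varphi_0,\dots,\varphi_n\rangle$ of $\varphi_n$ from $T$ in ZFC is a sequence in which each $\varphi_i$ is a logical axiom (a tautology; $\forall x\alpha\to\alpha^x_u$ or $\alpha^x_u\to\exists x\alpha$ with $u$ substitutable for $x$ in $\alpha$; $\forall x(\alpha\to\beta)\to(\forall x\alpha\to\forall x\beta)$; $\alpha\to\forall x\alpha$ with $x$ not free in $\alpha$; $x=x$; or $x=y\to(\alpha\to\beta)$ with $\alpha$ atomic and $\beta$ obtained from $\alpha$ by replacing one occurrence of $x$ by $y$), or an axiom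 of ZFC, or a member of $T$, or satisfies $\varphi_j=(\varphi_k\to\varphi_i)$ for some $j,k<i$, or satisfies $\varphi_i=\forall x_k\varphi_j$ for some $j<i$ and $k\in\omega$. An adjoint check sequence $\langle g_0,\dots,g_n\rangle$ of $\pi$ chooses for each $i$ one of these five reasons (with its indices $j,k$) that applies to $\varphi_i$; the corresponding checkers are $\mathbf G_\Lambda,\mathbf G_{\rm ZFC},\mathbf G_{\rm IN},\mathbf G_{\to},\mathbf G_\forall$. The adjoint checker $\mathbf{CK}_\pi$, on input a theory $\langle U,b\rangle$ (with an algorithm $b$ deciding membership in $U$) and a formula sequence $\sigma$, returns $1$ if $\sigma$ has the length of $\pi$ and every check $g_i$, applied to $\sigma$ and $\langle U,b\rangle$ (where $\mathbf G_{\rm IN}$ uses $b$), succeeds; otherwise it returns $0$. A normal proof of $M(r)=v$ is a proof of $\exists i\; t_{i,1}=(v,q_{halt},1)$ from $\mathbf T_{\langle M,r\rangle}$ in ZFC. \textbf{Lemma (bounded running time).} Let $M$ be a Turing machine, $v\in\{0,1\}$, $r\in\{0,1\}^*$, $M(r)=v$, let $\pi=\langle\varphi_0,\dots,\varphi_n\rangle$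 be a normal proof of $M(r)=v$, and fix an adjoint check sequence $\langle g_0,\dots,g_n\rangle$ of it. Then: (1) There is a Turing machine $\mathbf f$, halting on all inputs, with $\mathbf f(s)=\mathbf{CK}_\pi(\langle\mathbf T_{\langle M,s\rangle},\mathbf{AL}\rangle,\pi)$ for all $s\in\{0,1\}^*$, whose time complexity is bounded: there is a number $K$ with $t_{\mathbf f}(\|s\|)<K$ for all $s\in\{0,1\}^*$. (2) Only the $\mathbf G_{\rm IN}$ checks depend on $s$: for every $i$ such that $g_i$ is not of type $\mathbf G_{\rm IN}$, the check $g_i$ on $(\langle\mathbf T_{\langle M,s\rangle},\mathbf{AL}\rangle,\pi)$ returns $1$ for all $s$. (3) Each $\mathbf G_{\rm IN}$ check looks at a bounded part of $\mathbf T_{\langle M,s\rangle}$: if $g_i$ is of type $\mathbf G_{\rm IN}$, then for all $s$ its value on $(\langle\mathbf T_{\langle M,s\rangle},\mathbf{AL}\rangle,\pi)$ is the answer of $\mathbf{AL}$ for $\varphi_i$ and the sequence of the first $N$ members of $\mathbf T_{\langle M,s\rangle}$ (all of them if there are fewer), where $N$ is the number of members of $\mathbf T_{\langle M,r\rangle}$.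 -/

import Mathlib

namespace NormalProof

/-! ### Formulas of set theory

First-order formulas with named variables `x₀, x₁, …` in the language with `=`, `∈` and one
constant `tbl`, the letter `t` that stands for the table of a Turing machine. All other set
theoretic vocabulary is abbreviation. -/

inductive Trm where
  | var (k : ℕ)
  | tbl
  deriving DecidableEq

inductive Fml where
  | eq (a b : Trm)
  | mem (a b : Trm)
  | neg (φ : Fml)
  | imp (φ ψ : Fml)
  | all (k : ℕ) (φ : Fml)
  deriving DecidableEq

abbrev v (k : ℕ) : Trm := Trm.var k

namespace Fml

def or (φ ψ : Fml) : Fml := imp (neg φ) ψ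
def and (φ ψ : Fml) : Fml := neg (imp φ (neg ψ))
def iff (φ ψ : Fml) : Fml := and (imp φ ψ) (imp ψ φ)
def ex (k : ℕ) (φ : Fml) : Fml := neg (all k (neg φ))
/-- `∀ x_k (x_k ∈ a → φ)` -/
def allIn (k : ℕ) (a : Trm) (φ : Fml) : Fml := all k (imp (mem (v k) a) φ)
/-- `∃ x_k (x_k ∈ a ∧ φ)` -/
def exIn (k : ℕ) (a : Trm) (φ : Fml) : Fml := ex k (and (mem (v k) a) φ)

/-- A false formula, the value of the empty disjunction. -/
def bot : Fml := neg (all 0 (eq (v 0) (v 0)))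
/-- Finite disjunction. -/
def disj : List Fml → Fml
  | [] => bot
  | φ :: l => or φ (disj l)

end Fml

/-- The variable `x_k` occurs in the term. -/
def Trm.Occurs (k : ℕ) (a : Trm) : Prop := a = Trm.var k

/-- The variable `x_k` occurs free in the formula. -/
def Fml.Free (k : ℕ) : Fml → Prop
  | Fml.eq a b => a.Occurs k ∨ b.Occurs k
  | Fml.mem a b => a.Occurs k ∨ b.Occurs k
  | Fml.neg φ => φ.Free k
  | Fml.imp φ ψ => φ.Free k ∨ ψ.Free k
  | Fml.all m φ => k ≠ m ∧ φ.Free k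

def Trm.subst (k : ℕ) (u : Trm) (a : Trm) : Trm := if a = Trm.var k then u else a

/-- `α_u^{x_k}`: the term `u` replaces the free occurrences of `x_k`. -/
def Fml.subst (k : ℕ) (u : Trm) : Fml → Fml
  | Fml.eq a b => Fml.eq (a.subst k u) (b.subst k u)
  | Fml.mem a b => Fml.mem (a.subst k u) (b.subst k u)
  | Fml.neg φ => Fml.neg (φ.subst k u)
  | Fml.imp φ ψ => Fml.imp (φ.subst k u) (ψ.subst k u)
  | Fml.all m φ => if m = k then Fml.all m φ else Fml.all m (φ.subst k u)

/-- The term `u` is substitutable for `x_k` in the formula. -/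
def Fml.Substitutable (k : ℕ) (u : Trm) : Fml → Prop
  | Fml.eq _ _ => True
  | Fml.mem _ _ => True
  | Fml.neg φ => φ.Substitutable k u
  | Fml.imp φ ψ => φ.Substitutable k u ∧ ψ.Substitutable k u
  | Fml.all m φ => ¬ (Fml.all m φ).Free k ∨ (¬ u.Occurs m ∧ φ.Substitutable k u)

/-- Tautologies: true under every valuation of the prime (atomic or universal) formulas. -/
def IsTautology (φ : Fml) : Prop :=
  ∀ val : Fml → Prop,
    (∀ α, val (Fml.neg α) ↔ ¬ val α) →
    (∀ α β, val (Fml.imp α β) ↔ (val α → val β)) → val φ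

/-- Both formulas are atomic and the second one arises from the first one by replacing one
occurrence of the variable `x_k` by the variable `x_m`. -/
inductive ReplaceOne (k m : ℕ) : Fml → Fml → Prop
  | eqLeft (b : Trm) : ReplaceOne k m (Fml.eq (v k) b) (Fml.eq (v m) b)
  | eqRight (a : Trm) : ReplaceOne k m (Fml.eq a (v k)) (Fml.eq a (v m))
  | memLeft (b : Trm) : ReplaceOne k m (Fml.mem (v k) b) (Fml.mem (v m) b)
  | memRight (a : Trm) : ReplaceOne k m (Fml.mem a (v k)) (Fml.mem a (v m))

/-- The set `Λ` of logical postulates, in seven groups. -/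
inductive Logical : Fml → Prop
  | taut (φ : Fml) : IsTautology φ → Logical φ
  | inst (k : ℕ) (u : Trm) (α : Fml) : α.Substitutable k u →
      Logical (Fml.imp (Fml.all k α) (α.subst k u))
  | distrib (k : ℕ) (α β : Fml) :
      Logical (Fml.imp (Fml.all k (Fml.imp α β)) (Fml.imp (Fml.all k α) (Fml.all k β)))
  | vacuous (k : ℕ) (α : Fml) : ¬ α.Free k → Logical (Fml.imp α (Fml.all k α))
  | refl (k : ℕ) : Logical (Fml.eq (v k) (v k))
  | replace (k m : ℕ) (α β : Fml) : ReplaceOne k m α β →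
      Logical (Fml.imp (Fml.eq (v k) (v m)) (Fml.imp α β))
  | exIntro (k : ℕ) (u : Trm) (α : Fml) : α.Substitutable k u →
      Logical (Fml.imp (α.subst k u) (Fml.ex k α))

/-! ### Set theoretic abbreviations

In each abbreviation the number `n` is a level: the bound variables are `x_n, x_{n+1}, …`, so
the abbreviation has its intended meaning when the terms it is applied to only involve variables
of index below `n`. -/

/-- `x = ∅` -/
def isEmpty (n : ℕ) (x : Trm) : Fml := Fml.all n (Fml.neg (Fml.mem (v n) x))

/-- `y = x ∪ {x}` -/
def isSucc (n : ℕ) (x y : Trm) : Fml :=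
  Fml.all n (Fml.iff (Fml.mem (v n) y) (Fml.or (Fml.mem (v n) x) (Fml.eq (v n) x)))

/-- `p = {x, y}` -/
def isUPair (n : ℕ) (x y p : Trm) : Fml :=
  Fml.all n (Fml.iff (Fml.mem (v n) p) (Fml.or (Fml.eq (v n) x) (Fml.eq (v n) y)))

/-- `p = ⟨x, y⟩ = {{x}, {x, y}}` -/
def isPair (n : ℕ) (x y p : Trm) : Fml :=
  Fml.ex n (Fml.ex (n + 1) (Fml.and (isUPair (n + 2) x x (v n))
    (Fml.and (isUPair (n + 2) x y (v (n + 1))) (isUPair (n + 2) (v n) (v (n + 1)) p))))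

/-- `z = (x, y, c) = ⟨⟨x, y⟩, c⟩` -/
def isTriple (n : ℕ) (x y c z : Trm) : Fml :=
  Fml.ex n (Fml.and (isPair (n + 1) x y (v n)) (isPair (n + 1) (v n) c z))

/-- `x` is the natural number `k` -/
def isNum (n : ℕ) : ℕ → Trm → Fml
  | 0, x => isEmpty n x
  | k + 1, x => Fml.ex n (Fml.and (isNum (n + 1) k (v n)) (isSucc (n + 1) (v n) x))

/-- `x` contains `∅` and is closed under `y ↦ y ∪ {y}` -/
def isInductive (n : ℕ) (x : Trm) : Fml :=
  Fml.and (Fml.exIn n x (isEmpty (n + 1) (v n)))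
    (Fml.allIn n x (Fml.exIn (n + 1) x (isSucc (n + 2) (v n) (v (n + 1)))))

/-- `x ∈ ω` -/
def isNat (n : ℕ) (x : Trm) : Fml :=
  Fml.all n (Fml.imp (isInductive (n + 1) (v n)) (Fml.mem x (v n)))

/-- `∀ x_k ∈ ω, φ` -/
def Fml.allNat (k : ℕ) (φ : Fml) : Fml := Fml.all k (Fml.imp (isNat (k + 1) (v k)) φ)
/-- `∃ x_k ∈ ω, φ` -/
def Fml.exNat (k : ℕ) (φ : Fml) : Fml := Fml.ex k (Fml.and (isNat (k + 1) (v k)) φ)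

/-- `⟨x, y⟩ ∈ f` -/
def isApp (n : ℕ) (f x y : Trm) : Fml :=
  Fml.exIn n f (isPair (n + 1) x y (v n))

/-- `f` is a function with domain `ω` all of whose values satisfy `P`. Here `P m y` is the
formula, of level `m`, that says `P` about `y`. -/
def isSeqOf (n : ℕ) (P : ℕ → Trm → Fml) (f : Trm) : Fml :=
  Fml.and
    (Fml.allIn n f (Fml.exNat (n + 1) (Fml.ex (n + 2)
      (Fml.and (isPair (n + 3) (v (n + 1)) (v (n + 2)) (v n)) (P (n + 3) (v (n + 2)))))))
    (Fml.allNat n (Fml.ex (n + 1) (Fml.all (n + 2)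
      (Fml.iff (isApp (n + 3) f (v n) (v (n + 2))) (Fml.eq (v (n + 2)) (v (n + 1)))))))

/-! ### The theory ZFC

Parameters of the two schemes are left free; the universal closures follow by generalization. -/

inductive ZFC : Fml → Prop
  | extensionality : ZFC (Fml.all 0 (Fml.all 1 (Fml.imp
      (Fml.all 2 (Fml.iff (Fml.mem (v 2) (v 0)) (Fml.mem (v 2) (v 1)))) (Fml.eq (v 0) (v 1)))))
  | foundation : ZFC (Fml.all 0 (Fml.imp (Fml.ex 1 (Fml.mem (v 1) (v 0)))
      (Fml.exIn 1 (v 0) (Fml.neg (Fml.exIn 2 (v 0) (Fml.mem (v 2) (v 1)))))))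
  | pairing : ZFC (Fml.all 0 (Fml.all 1 (Fml.ex 2 (isUPair 3 (v 0) (v 1) (v 2)))))
  | union : ZFC (Fml.all 0 (Fml.ex 1 (Fml.all 2
      (Fml.iff (Fml.mem (v 2) (v 1)) (Fml.exIn 3 (v 0) (Fml.mem (v 2) (v 3)))))))
  | powerSet : ZFC (Fml.all 0 (Fml.ex 1 (Fml.all 2
      (Fml.iff (Fml.mem (v 2) (v 1)) (Fml.allIn 3 (v 2) (Fml.mem (v 3) (v 0)))))))
  | infinity : ZFC (Fml.ex 0 (isInductive 1 (v 0)))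
  /-- `∀ z ∃ y ∀ x (x ∈ y ↔ x ∈ z ∧ φ)` -/
  | separation (x y z : ℕ) (φ : Fml) : x ≠ y → x ≠ z → y ≠ z → ¬ φ.Free y →
      ZFC (Fml.all z (Fml.ex y (Fml.all x
        (Fml.iff (Fml.mem (v x) (v y)) (Fml.and (Fml.mem (v x) (v z)) φ)))))
  /-- `∀ a ((∀ x ∈ a) ∃ z ∀ y (φ ↔ y = z) → ∃ b (∀ x ∈ a) (∃ y ∈ b) φ)` -/
  | replacement (x y z a b : ℕ) (φ : Fml) : [x, y, z, a, b].Nodup → ¬ φ.Free z → ¬ φ.Free b →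
      ZFC (Fml.all a (Fml.imp
        (Fml.allIn x (v a) (Fml.ex z (Fml.all y (Fml.iff φ (Fml.eq (v y) (v z))))))
        (Fml.ex b (Fml.allIn x (v a) (Fml.exIn y (v b) φ)))))
  /-- Every set of non-empty pairwise disjoint sets has a set meeting each of them in exactly
  one point. -/
  | choice : ZFC (Fml.all 0 (Fml.imp
      (Fml.and (Fml.allIn 1 (v 0) (Fml.ex 2 (Fml.mem (v 2) (v 1))))
        (Fml.allIn 1 (v 0) (Fml.allIn 2 (v 0) (Fml.imp (Fml.neg (Fml.eq (v 1) (v 2)))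
          (Fml.neg (Fml.exIn 3 (v 1) (Fml.mem (v 3) (v 2))))))))
      (Fml.ex 4 (Fml.allIn 1 (v 0) (Fml.ex 2 (Fml.all 3
        (Fml.iff (Fml.and (Fml.mem (v 3) (v 1)) (Fml.mem (v 3) (v 4)))
          (Fml.eq (v 3) (v 2)))))))))

/-! ### Turing machines -/

/-- The tape alphabet `{0, 1, ⊔, ▷}`. -/
inductive Sym where
  | zero | one | blank | start
  deriving DecidableEq

/-- The moves `L`, `S` (stay) and `R`. -/
inductive Move where
  | left | stay | right
  deriving DecidableEq

def Sym.ofBool (b : Bool) : Sym := if b then Sym.one else Sym.zero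
def Sym.list : List Sym := [Sym.zero, Sym.one, Sym.blank, Sym.start]

structure TM where
  /-- The states are the elements of `Fin card`. -/
  card : ℕ
  δ : Fin card → Sym → Fin card × Sym × Move
  q₀ : Fin card
  qhalt : Fin card
  /-- The left end mark is kept and left to the right, except in the halt state. -/
  start_right : ∀ q, q ≠ qhalt → (δ q Sym.start).2 = (Sym.start, Move.right)
  start_only : ∀ q a, a ≠ Sym.start → (δ q a).2.1 ≠ Sym.start
  halt_stay : ∀ a, δ qhalt a = (qhalt, a, Move.stay)
  halt_unique : ∀ q, (∀ a, δ q a = δ qhalt a) → q = qhalt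

namespace TM

/-- A configuration: state, position of the head, tape contents. -/
structure Config (F : TM) where
  state : Fin F.card
  head : ℕ
  tape : ℕ → Sym

/-- On input `s` the tape is `▷ s ⊔ ⊔ …` and the head is at square `0`. -/
def init (F : TM) (s : List Bool) : F.Config where
  state := F.q₀
  head := 0
  tape := fun j => match j with
    | 0 => Sym.start
    | j + 1 => match s[j]? with
      | some b => Sym.ofBool b
      | none => Sym.blank

def step (F : TM) (c : F.Config) : F.Config where
  state := (F.δ c.state (c.tape c.head)).1
  head := match (F.δ c.state (c.tape c.head)).2.2 with
    | Move.left => c.head - 1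
    | Move.stay => c.head
    | Move.right => c.head + 1
  tape := Function.update c.tape c.head (F.δ c.state (c.tape c.head)).2.1

/-- The configuration after `i` steps on input `s`. -/
def run (F : TM) (s : List Bool) (i : ℕ) : F.Config := F.step^[i] (F.init s)

/-- `F(s) = b`: at some step the machine is in the halt state and reads square `1`, which
contains `b`. -/
def Outputs (F : TM) (s : List Bool) (b : Bool) : Prop :=
  ∃ i, (F.run s i).state = F.qhalt ∧ (F.run s i).head = 1 ∧ (F.run s i).tape 1 = Sym.ofBool b

def HaltsOn (F : TM) (s : List Bool) : Prop := ∃ i, (F.run s i).state = F.qhalt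

/-- The number of steps that the machine uses on input `s`. -/
def steps (F : TM) (s : List Bool) (h : F.HaltsOn s) : ℕ := Nat.find h

/-- The time complexity `t_F(n)`: the maximal number of steps on the inputs of length `n`. -/
def timeComplexity (F : TM) (h : ∀ s, F.HaltsOn s) (n : ℕ) : ℕ :=
  Finset.univ.sup fun w : Fin n → Bool => F.steps (List.ofFn w) (h (List.ofFn w))

end TM

/-! ### The formula sequence describing a machine and its input

A tape square is a triple (symbol, state, flag), where the flag tells whether the square is
being read. Symbols, states and flags are coded by natural numbers. -/

def Sym.code : Sym → ℕ
  | Sym.zero => 0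
  | Sym.one => 1
  | Sym.blank => 2
  | Sym.start => 3

section Squares

variable (M : TM)

/-- `z = (a, q, b)` -/
def isSquare (n : ℕ) (a : Sym) (q : Fin M.card) (b : Bool) (z : Trm) : Fml :=
  Fml.ex n (Fml.ex (n + 1) (Fml.ex (n + 2) (Fml.and (isNum (n + 3) a.code (v n))
    (Fml.and (isNum (n + 3) q.val (v (n + 1))) (Fml.and (isNum (n + 3) b.toNat (v (n + 2)))
      (isTriple (n + 3) (v n) (v (n + 1)) (v (n + 2)) z))))))

/-- `z ∈ A × Q × B` -/
def isSquareIn (A : List Sym) (B : List Bool) (n : ℕ) (z : Trm) : Fml :=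
  Fml.disj (A.flatMap fun a => (List.finRange M.card).flatMap fun q =>
    B.map fun b => isSquare M n a q b z)

/-- `z = t_{i,j}`, that is, `z = t(i)(j)` -/
def isCell (n : ℕ) (i j z : Trm) : Fml :=
  Fml.ex n (Fml.and (isApp (n + 1) Trm.tbl i (v n)) (isApp (n + 1) (v n) j z))

/-- `t_{i,j} ∈ A × Q × B` -/
def cellIn (A : List Sym) (B : List Bool) (n : ℕ) (i j : Trm) : Fml :=
  Fml.ex n (Fml.and (isCell (n + 1) i j (v n)) (isSquareIn M A B (n + 1) (v n)))

/-- `t_{i,j} = (a, q, b)` -/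
def cellEq (n : ℕ) (i j : Trm) (a : Sym) (q : Fin M.card) (b : Bool) : Fml :=
  Fml.ex n (Fml.and (isCell (n + 1) i j (v n)) (isSquare M (n + 1) a q b (v n)))

/-- `t_{i',j} = (π_M(t_{i,j}), p, b)`, where `π_M` is the projection to the symbol -/
def cellCopy (n : ℕ) (i' i j : Trm) (p : Fin M.card) (b : Bool) : Fml :=
  -- `x_n` is the symbol, `x_{n+1}`, `x_{n+2}` the old state and flag, `x_{n+3}` the old square
  Fml.ex n (Fml.and
    (Fml.ex (n + 1) (Fml.ex (n + 2) (Fml.ex (n + 3) (Fml.and (isCell (n + 4) i j (v (n + 3)))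
      (isTriple (n + 4) (v n) (v (n + 1)) (v (n + 2)) (v (n + 3)))))))
    -- `x_{n+1}`, `x_{n+2}` are the new state and flag, `x_{n+3}` is the new square
    (Fml.ex (n + 1) (Fml.ex (n + 2) (Fml.ex (n + 3) (Fml.and (isCell (n + 4) i' j (v (n + 3)))
      (Fml.and (isNum (n + 4) p.val (v (n + 1))) (Fml.and (isNum (n + 4) b.toNat (v (n + 2)))
        (isTriple (n + 4) (v n) (v (n + 1)) (v (n + 2)) (v (n + 3))))))))))

/-- `t_{0,j} = (a, q, b)` -/
def rowZeroEq (n : ℕ) (j : Trm) (a : Sym) (q : Fin M.card) (b : Bool) : Fml :=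
  Fml.ex n (Fml.and (isNum (n + 1) 0 (v n)) (cellEq M (n + 1) (v n) j a q b))

/-- `t ∈ Table_M`: a sequence of sequences of elements of `Γ × Q × {0,1}` -/
def isTable : Fml :=
  isSeqOf 0 (fun n y => isSeqOf n (isSquareIn M Sym.list [false, true]) y) Trm.tbl

/-- `∀ i, t_{i,0} ∈ {▷} × Q × {0,1}` -/
def leftEnd : Fml :=
  Fml.allNat 0 (Fml.ex 1 (Fml.and (isNum 2 0 (v 1))
    (cellIn M [Sym.start] [false, true] 2 (v 0) (v 1))))

/-- `∀ i ∃ k (t_{i,k} ∈ Γ × Q × {1} ∧ ∀ j (j ≠ k → t_{i,j} ∈ Γ × Q × {0}))` -/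
def oneHead : Fml :=
  Fml.allNat 0 (Fml.exNat 1 (Fml.and (cellIn M Sym.list [true] 2 (v 0) (v 1))
    (Fml.allNat 2 (Fml.imp (Fml.neg (Fml.eq (v 2) (v 1)))
      (cellIn M Sym.list [false] 3 (v 0) (v 2))))))

/-- The interpretation of `δ(q, a)`. In it `x_0` is `i`, `x_1` is `j`, `x_2` is `i + 1` and, for
the moves `L` and `R`, `x_3` is `j - 1` and `j + 1` respectively; `x_4` is `k`. -/
def transition (q : Fin M.card) (a : Sym) : Fml :=
  Fml.allNat 0 (Fml.allNat 1 (Fml.imp (cellEq M 2 (v 0) (v 1) a q true)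
    (Fml.ex 2 (Fml.and (isSucc 3 (v 0) (v 2))
      (match M.δ q a with
        | (p, b, Move.left) =>
          Fml.exNat 3 (Fml.and (isSucc 4 (v 3) (v 1))
            (Fml.and (cellEq M 4 (v 2) (v 1) b p false)
              (Fml.and (cellCopy M 4 (v 2) (v 0) (v 3) p true)
                (Fml.allNat 4 (Fml.imp
                  (Fml.and (Fml.neg (Fml.eq (v 4) (v 1))) (Fml.neg (Fml.eq (v 4) (v 3))))
                  (cellCopy M 5 (v 2) (v 0) (v 4) p false))))))
        | (p, b, Move.stay) =>
          Fml.and (cellEq M 4 (v 2) (v 1) b p true)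
            (Fml.allNat 4 (Fml.imp (Fml.neg (Fml.eq (v 4) (v 1)))
              (cellCopy M 5 (v 2) (v 0) (v 4) p false)))
        | (p, b, Move.right) =>
          Fml.exNat 3 (Fml.and (isSucc 4 (v 1) (v 3))
            (Fml.and (cellEq M 4 (v 2) (v 1) b p false)
              (Fml.and (cellCopy M 4 (v 2) (v 0) (v 3) p true)
                (Fml.allNat 4 (Fml.imp
                  (Fml.and (Fml.neg (Fml.eq (v 4) (v 1))) (Fml.neg (Fml.eq (v 4) (v 3))))
                  (cellCopy M 5 (v 2) (v 0) (v 4) p false)))))))))))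

/-- `∃ m (∀ j (j < m → t_{0,j} ≠ (⊔, q₀, 0)) ∧ ∀ j (j ≥ m → t_{0,j} = (⊔, q₀, 0)))` -/
def finiteInput : Fml :=
  Fml.exNat 0 (Fml.and
    (Fml.allNat 1 (Fml.imp (Fml.mem (v 1) (v 0))
      (Fml.neg (rowZeroEq M 2 (v 1) Sym.blank M.q₀ false))))
    (Fml.allNat 1 (Fml.imp (Fml.or (Fml.mem (v 0) (v 1)) (Fml.eq (v 1) (v 0)))
      (rowZeroEq M 2 (v 1) Sym.blank M.q₀ false))))

/-- The formula sequence `def_M`. -/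
def defM : List Fml :=
  [isTable M, leftEnd M, oneHead M] ++
    ((List.finRange M.card).flatMap fun q => Sym.list.map fun a => transition M q a) ++
    [finiteInput M]

/-- `∀ j (j > len → t_{0,j} = (⊔, q₀, 0))` -/
def blanksAfter (len : ℕ) : Fml :=
  Fml.allNat 0 (Fml.imp (Fml.ex 1 (Fml.and (isNum 2 len (v 1)) (Fml.mem (v 1) (v 0))))
    (rowZeroEq M 1 (v 0) Sym.blank M.q₀ false))

/-- `t_{0,j} = (a, q₀, b)` for a given number `j` -/
def inputCell (j : ℕ) (a : Sym) (b : Bool) : Fml :=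
  Fml.ex 0 (Fml.and (isNum 1 j (v 0)) (rowZeroEq M 1 (v 0) a M.q₀ b))

/-- The formula sequence `input_s`. -/
def inputS (s : List Bool) : List Fml :=
  [blanksAfter M s.length, inputCell M 0 Sym.start true] ++
    s.mapIdx fun j b => inputCell M (j + 1) (Sym.ofBool b) false

/-- The formula sequence `T_{⟨M,s⟩}`: first `def_M`, then `input_s`. -/
def theoryMS (s : List Bool) : List Fml := defM M ++ inputS M s

/-- `∃ i, t_{i,1} = (b, q_halt, 1)` -/
def haltsWith (b : Bool) : Fml :=
  Fml.exNat 0 (Fml.ex 1 (Fml.and (isNum 2 1 (v 1))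
    (cellEq M 2 (v 0) (v 1) (Sym.ofBool b) M.qhalt true)))

end Squares

/-! ### Proofs and their checkers -/

/-- A finite theory, given as a formula sequence, with an algorithm deciding membership in it.
(A finite set is always recursive, so no further condition on the algorithm is needed.) -/
structure RTheory where
  T : List Fml
  al : Fml → List Fml → Bool
  correct : ∀ φ, al φ T = true ↔ φ ∈ T

/-- The algorithm `AL`: compare `φ` with the members of the sequence one after the other. -/
def AL (φ : Fml) : List Fml → Bool
  | [] => false
  | ψ :: l => if φ = ψ then true else AL φ l

theorem AL_correct (φ : Fml) (l : List Fml) : AL φ l = true ↔ φ ∈ l := by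
  induction l with
  | nil => simp [AL]
  | cons ψ l ih =>
    by_cases h : φ = ψ
    · simp [AL, h]
    · simp [AL, h, ih]

/-- `⟨T_{⟨M,s⟩}, AL⟩` -/
def theoryAL (M : TM) (s : List Bool) : RTheory where
  T := theoryMS M s
  al := AL
  correct := fun φ => AL_correct φ _

/-- The five types of checkers. -/
inductive Checker where
  /-- `G_Λ` -/
  | logical
  /-- `G_ZFC` -/
  | zfc
  /-- `G_IN` -/
  | member
  /-- `G_→(·, ·, j, k)` -/
  | mp (j k : ℕ)
  /-- `G_∀(·, ·, j, k)` -/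
  | gen (j k : ℕ)

/-- The condition on the `i`-th formula of `π` that goes with a checker. -/
def Checker.Cond (S : RTheory) (π : List Fml) (i : ℕ) : Checker → Prop
  | Checker.logical => ∃ φ, π[i]? = some φ ∧ Logical φ
  | Checker.zfc => ∃ φ, π[i]? = some φ ∧ ZFC φ
  | Checker.member => ∃ φ, π[i]? = some φ ∧ φ ∈ S.T
  | Checker.mp j k => j < i ∧ k < i ∧
      ∃ φ ψ, π[i]? = some φ ∧ π[k]? = some ψ ∧ π[j]? = some (Fml.imp ψ φ)
  | Checker.gen j k => j < i ∧ ∃ ψ, π[j]? = some ψ ∧ π[i]? = some (Fml.all k ψ)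

/-- `S ⊢^π φ`: the sequence `π` ends with `φ`, and each of its members is in `Λ`, or in ZFC, or
in the theory, or follows from earlier ones by modus ponens or by generalization. -/
def Proves (S : RTheory) (π : List Fml) (φ : Fml) : Prop :=
  π.getLast? = some φ ∧ ∀ i < π.length, ∃ g : Checker, g.Cond S π i

/-- `π` is a normal proof of `M(s) = b`. -/
def IsNormalProof (M : TM) (s : List Bool) (b : Bool) (π : List Fml) : Prop :=
  Proves (theoryAL M s) π (haltsWith M b)

open Classical in
/-- The value of a checker at the `i`-th member of `σ`; `G_IN` calls the decision algorithm of
the theory, the other checkers do not use the theory. -/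
noncomputable def Checker.run (g : Checker) (S : RTheory) (σ : List Fml) (i : ℕ) : Bool :=
  match g with
  | Checker.member => match σ[i]? with
    | some φ => S.al φ S.T
    | none => false
  | g => decide (Checker.Cond S σ i g)

/-- `G` is an adjoint check sequence (proof type) of `S ⊢^π φ`: it has the length of `π`, and the
type of each checker is one of the reasons for which the formula is allowed in the proof. -/
def IsCheckSeq (S : RTheory) (π : List Fml) (G : List Checker) : Prop :=
  G.length = π.length ∧ ∀ (i : ℕ) (g : Checker), G[i]? = some g → g.Cond S π i

/-- The adjoint checker of a proof with adjoint check sequence `G`, on input `(S, σ)`: it compares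
the lengths and then runs the checkers of `G` on `σ`. -/
noncomputable def CK (G : List Checker) (S : RTheory) (σ : List Fml) : Bool :=
  if σ.length ≠ G.length then false
  else (G.mapIdx fun i g => g.run S σ i).all id

end NormalProof

namespace NormalProof

/-! ### Membership in the formula sequence of a machine and an input -/

/-! The proof `π` is fixed, and only its `G_IN` checks consult the theory. Each formula `φ` so
checked belongs to `T_{⟨M,r⟩}`, so it is in `def_M`, or is the blank-tail formula for `|r|`, or
describes a square of index at most `|r|`. A numeral can be read off the formula containing it
(`isNum_injective`). Hence whether `φ` lies in `T_{⟨M,s⟩}` depends only on whether `|s| = |r|` and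
on the letters `s_j` with `j < |r|`. Moreover, if `φ` does occur there, it already occurs among the
first `|T_{⟨M,r⟩}|` members (`mem_theoryMS_iff_mem_take`). The other checks succeed for `r` and
never mention the theory, so they succeed for every `s`.

The checker's value is thus a function of the first `|r| + 1` letters of `s` (`CK_take_input`). Such
a function has finitely many values to tabulate, so a machine can hold the prefix in its state, look
the value up in its transition table, return to the left end and write the answer
(`TM.exists_computes_prefix`). No decision procedure for the logical or ZFC axioms is needed. -/

theorem isNum_injective (n k k' : ℕ) (x : Trm) (h : isNum n k x = isNum n k' x) : k = k' := by
  -- Level and term must vary, since each successor passes under a quantifier that raises the level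
  -- and changes the term.
  induction k generalizing n k' x with
  | zero =>
    cases k' with
    | zero => rfl
    | succ k' => simp [isNum, isEmpty, Fml.ex] at h
  | succ k ih =>
    cases k' with
    | zero => simp [isNum, isEmpty, Fml.ex] at h
    | succ k' =>
      simp only [isNum, Fml.ex, Fml.and, Fml.neg.injEq, Fml.all.injEq, Fml.imp.injEq] at h
      rw [ih _ _ _ h.2.1]

theorem blanksAfter_injective (M : TM) {k k' : ℕ} (h : blanksAfter M k = blanksAfter M k') :
    k = k' := by
  simp only [blanksAfter, Fml.allNat, Fml.ex, Fml.and, Fml.neg.injEq, Fml.all.injEq,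
    Fml.imp.injEq] at h
  exact isNum_injective _ _ _ _ h.2.2.1.2.1

theorem inputCell_index_injective (M : TM) {j j' : ℕ} {a a' : Sym} {b b' : Bool}
    (h : inputCell M j a b = inputCell M j' a' b') : j = j' := by
  simp only [inputCell, Fml.ex, Fml.and, Fml.neg.injEq, Fml.all.injEq, Fml.imp.injEq] at h
  exact isNum_injective _ _ _ _ h.2.1

theorem blanksAfter_ne_inputCell (M : TM) (k j : ℕ) (a : Sym) (b : Bool) :
    blanksAfter M k ≠ inputCell M j a b := by
  simp [blanksAfter, inputCell, Fml.allNat, Fml.ex]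

/-- Beyond `def_M` come two formulas present for every input, so a cut at `|def_M| + 2 + n` keeps
exactly the first `n` letter formulas. -/
theorem mem_theoryMS_take (M : TM) (s : List Bool) (n : ℕ) (φ : Fml) :
    φ ∈ (theoryMS M s).take ((defM M).length + 2 + n) ↔
      φ ∈ defM M ∨ φ = blanksAfter M s.length ∨ φ = inputCell M 0 Sym.start true ∨
        ∃ j c, j < n ∧ s[j]? = some c ∧ φ = inputCell M (j + 1) (Sym.ofBool c) false := by
  have h : (theoryMS M s).take ((defM M).length + 2 + n) =
      defM M ++ blanksAfter M s.length :: inputCell M 0 Sym.start true ::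
        (s.mapIdx fun j b => inputCell M (j + 1) (Sym.ofBool b) false).take n := by
    rw [theoryMS, inputS, add_assoc, List.take_length_add_append, add_comm 2 n]
    simp
  rw [h]
  simp only [List.mem_append, List.mem_cons]
  refine or_congr_right (or_congr_right (or_congr_right ?_))
  rw [List.mem_iff_getElem?]
  constructor
  · rintro ⟨j, hj⟩
    rw [List.getElem?_take] at hj
    split_ifs at hj with hjn
    rw [List.getElem?_mapIdx, Option.map_eq_some_iff] at hj
    obtain ⟨c, hc, rfl⟩ := hj
    exact ⟨j, c, hjn, hc, rfl⟩
  · rintro ⟨j, c, hjn, hc, rfl⟩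
    exact ⟨j, by simp [hjn, hc]⟩

theorem length_theoryMS (M : TM) (s : List Bool) :
    (theoryMS M s).length = (defM M).length + 2 + s.length := by
  simp [theoryMS, inputS]; omega

theorem mem_theoryMS (M : TM) (s : List Bool) (φ : Fml) :
    φ ∈ theoryMS M s ↔
      φ ∈ defM M ∨ φ = blanksAfter M s.length ∨ φ = inputCell M 0 Sym.start true ∨
        ∃ j c, s[j]? = some c ∧ φ = inputCell M (j + 1) (Sym.ofBool c) false := by
  have h := mem_theoryMS_take M s s.length φ
  rw [← length_theoryMS, List.take_length] at h
  rw [h]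
  refine or_congr_right (or_congr_right (or_congr_right ?_))
  constructor
  · rintro ⟨j, c, -, h⟩
    exact ⟨j, c, h⟩
  · rintro ⟨j, c, hc, h⟩
    exact ⟨j, c, (List.getElem?_eq_some_iff.1 hc).1, hc, h⟩

/-- A member of `T_{⟨M,r⟩}` that belongs to `T_{⟨M,s⟩}` is among its first `|T_{⟨M,r⟩}|`
members. -/
theorem mem_theoryMS_iff_mem_take (M : TM) (r s : List Bool) (φ : Fml) (hr : φ ∈ theoryMS M r) :
    φ ∈ theoryMS M s ↔ φ ∈ (theoryMS M s).take (theoryMS M r).length := by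
  refine ⟨fun hs => ?_, List.mem_of_mem_take⟩
  rw [length_theoryMS, mem_theoryMS_take]
  rw [mem_theoryMS] at hr hs
  obtain hs | hs | hs | ⟨j, c, hc, rfl⟩ := hs
  · exact Or.inl hs
  · exact Or.inr (Or.inl hs)
  · exact Or.inr (Or.inr (Or.inl hs))
  -- Only a letter formula could lie beyond the cut; membership in `T_{⟨M,r⟩}` bounds its index by
  -- `|r|`. A coincidence with a formula of `def_M` is harmless, as `def_M` lies before the cut.
  · obtain hr | hr | hr | ⟨j', c', hc', hr⟩ := hr
    · exact Or.inl hr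
    · exact absurd hr.symm (blanksAfter_ne_inputCell M _ _ _ _)
    · exact absurd (inputCell_index_injective M hr) (Nat.succ_ne_zero j)
    · obtain rfl : j = j' := Nat.succ_injective (inputCell_index_injective M hr)
      exact Or.inr (Or.inr (Or.inr ⟨j, c, (List.getElem?_eq_some_iff.1 hc').1, hc, rfl⟩))

/-- The length of `s` enters only through the blank-tail formula, which, outside `def_M`, can be in
`T_{⟨M,r⟩}` only when `|s| = |r|`. So the lengths need to be compared with `|r|` only. -/
theorem mem_theoryMS_of_agree (M : TM) (r s s' : List Bool) (φ : Fml) (hr : φ ∈ theoryMS M r)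
    (hlen : s.length = r.length → s'.length = r.length)
    (hget : ∀ j < r.length, s'[j]? = s[j]?) (hs : φ ∈ theoryMS M s) : φ ∈ theoryMS M s' := by
  rw [mem_theoryMS_iff_mem_take M r s φ hr, length_theoryMS, mem_theoryMS_take] at hs
  rw [mem_theoryMS]
  obtain hs | rfl | hs | ⟨j, c, hj, hc, rfl⟩ := hs
  · exact Or.inl hs
  · rw [mem_theoryMS] at hr
    obtain hr | hr | hr | ⟨j, c, hc, hr⟩ := hr
    · exact Or.inl hr
    · have h := blanksAfter_injective M hr
      exact Or.inr (Or.inl (by rw [hlen h, h]))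
    · exact absurd hr (blanksAfter_ne_inputCell M _ _ _ _)
    · exact absurd hr (blanksAfter_ne_inputCell M _ _ _ _)
  · exact Or.inr (Or.inr (Or.inl hs))
  · exact Or.inr (Or.inr (Or.inr ⟨j, c, by rw [hget j hj, hc], rfl⟩))

/-- Whether a member of `T_{⟨M,r⟩}` belongs to `T_{⟨M,s⟩}` depends only on the first `|r| + 1`
letters of `s`. -/
theorem mem_theoryMS_take_input (M : TM) (r s : List Bool) (φ : Fml) (hr : φ ∈ theoryMS M r) :
    φ ∈ theoryMS M (s.take (r.length + 1)) ↔ φ ∈ theoryMS M s := by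
  have hget : ∀ j < r.length, (s.take (r.length + 1))[j]? = s[j]? := fun j hj => by
    rw [List.getElem?_take, if_pos (by omega)]
  -- The extra letter matters here: cutting at `|r|` would give longer inputs the length `|r|`,
  -- while cutting at `|r| + 1` preserves whether the length is `|r|`.
  refine ⟨mem_theoryMS_of_agree M r _ _ φ hr ?_ fun j hj => (hget j hj).symm,
    mem_theoryMS_of_agree M r _ _ φ hr ?_ hget⟩ <;>
  · rw [List.length_take]
    omega

/-! ### The adjoint checker -/

theorem Checker.run_member (M : TM) (s : List Bool) {π : List Fml} {i : ℕ} {φ : Fml}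
    (h : π[i]? = some φ) : Checker.member.run (theoryAL M s) π i = AL φ (theoryMS M s) := by
  simp only [Checker.run, h]
  rfl

/-- Apart from `G_IN`, no condition mentions the theory, so the one for `S` is literally the one for
`S'`. -/
theorem Checker.run_eq_true_of_ne_member {g : Checker} (hg : g ≠ Checker.member)
    {S : RTheory} (S' : RTheory) {σ : List Fml} {i : ℕ} (h : g.Cond S σ i) :
    g.run S' σ i = true := by
  cases g with
  | member => exact absurd rfl hg
  | logical => exact @decide_eq_true _ (Classical.propDecidable _) h
  | zfc => exact @decide_eq_true _ (Classical.propDecidable _) h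
  | mp j k => exact @decide_eq_true _ (Classical.propDecidable _) h
  | gen j k => exact @decide_eq_true _ (Classical.propDecidable _) h

theorem CK_take_input (M : TM) (r s : List Bool) (π : List Fml) (G : List Checker)
    (hG : IsCheckSeq (theoryAL M r) π G) :
    CK G (theoryAL M (s.take (r.length + 1))) π = CK G (theoryAL M s) π := by
  have h : (G.mapIdx fun i g => g.run (theoryAL M (s.take (r.length + 1))) π i) =
      G.mapIdx fun i g => g.run (theoryAL M s) π i := by
    apply List.ext_getElem?
    intro i
    rw [List.getElem?_mapIdx, List.getElem?_mapIdx]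
    cases hi : G[i]? with
    | none => rfl
    | some g =>
      have hc := hG.2 i g hi
      by_cases hg : g = Checker.member
      · subst hg
        obtain ⟨φ, hφ, hr⟩ := hc
        simp only [Option.map_some]
        rw [Checker.run_member M _ hφ, Checker.run_member M _ hφ, Option.some.injEq,
          Bool.eq_iff_iff, AL_correct, AL_correct]
        exact mem_theoryMS_take_input M r s φ hr
      · simp only [Option.map_some]
        rw [Checker.run_eq_true_of_ne_member hg _ hc, Checker.run_eq_true_of_ne_member hg _ hc]
  rw [CK, CK, h]

/-! ### A machine that computes a function of a bounded prefix of the input -/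

/-- The states of the prefix machine: it reads up to `m` letters, carries the value back to the
left end and writes it on square `1`. -/
inductive PrefixState (m : ℕ) where
  | halt
  | read (l : {l : List Bool // l.length ≤ m})
  | back (b : Bool)
  | out (b : Bool)

namespace PrefixState

instance (m : ℕ) : Finite (PrefixState m) := by
  have : Finite {l : List Bool // l.length ≤ m} := List.finite_length_le Bool m
  let f : PrefixState m → Option ({l : List Bool // l.length ≤ m} ⊕ Bool ⊕ Bool)
    | halt => none
    | read l => some (Sum.inl l)
    | back b => some (Sum.inr (Sum.inl b))
    | out b => some (Sum.inr (Sum.inr b))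
  refine Finite.of_injective f fun x y h => ?_
  cases x <;> cases y <;> simp_all [f]

variable {m : ℕ} (f : List Bool → Bool)

/-- Read the letter `c`, which is on the tape as `a`. -/
def readLetter (l : {l : List Bool // l.length ≤ m}) (c : Bool) (a : Sym) :
    PrefixState m × Sym × Move :=
  if h : l.1.length < m then
    (read ⟨l.1 ++ [c], by simpa using h⟩, a, Move.right)
  else (back (f l.1), a, Move.left)

/-- The value of `f` enters the state at the turn, on a blank or on a letter for which the memory is
full. The entry for `out` at the end mark serves only to satisfy `start_right`. -/
def next : PrefixState m → Sym → PrefixState m × Sym × Move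
  | halt, a => (halt, a, Move.stay)
  | read l, Sym.start => (read l, Sym.start, Move.right)
  | read l, Sym.blank => (back (f l.1), Sym.blank, Move.left)
  | read l, Sym.zero => readLetter f l false Sym.zero
  | read l, Sym.one => readLetter f l true Sym.one
  | back b, Sym.start => (out b, Sym.start, Move.right)
  | back b, a => (back b, a, Move.left)
  | out b, Sym.start => (out b, Sym.start, Move.right)
  | out b, _ => (halt, Sym.ofBool b, Move.stay)

theorem next_start {q : PrefixState m} (hq : q ≠ halt) :
    (next f q Sym.start).2 = (Sym.start, Move.right) := by
  cases q <;> first | exact absurd rfl hq | rfl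

theorem next_ne_start (q : PrefixState m) {a : Sym} (ha : a ≠ Sym.start) :
    (next f q a).2.1 ≠ Sym.start := by
  cases q with
  | halt => exact ha
  | read l =>
    cases a <;> first | exact absurd rfl ha | (simp only [next, readLetter]; try split_ifs) <;> simp
  | back b => cases a <;> first | exact absurd rfl ha | simp [next]
  | out b => cases a <;> first | exact absurd rfl ha | (cases b <;> simp [next, Sym.ofBool])

theorem next_ofBool (l : {l : List Bool // l.length ≤ m}) (c : Bool) :
    next f (read l) (Sym.ofBool c) = readLetter f l c (Sym.ofBool c) := by
  cases c <;> rfl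

theorem next_back (b : Bool) {a : Sym} (ha : a ≠ Sym.start) :
    next f (back b : PrefixState m) a = (back b, a, Move.left) := by
  cases a <;> first | rfl | exact absurd rfl ha

theorem next_out (b : Bool) {a : Sym} (ha : a ≠ Sym.start) :
    next f (out b : PrefixState m) a = (halt, Sym.ofBool b, Move.stay) := by
  cases a <;> first | rfl | exact absurd rfl ha

end PrefixState

open PrefixState

namespace TM

/-- The prefix machine, its states being numbered by `e`. -/
def prefixMachine {m n : ℕ} (e : PrefixState m ≃ Fin n) (f : List Bool → Bool) : TM where
  card := n
  δ q a := (e (next f (e.symm q) a).1, (next f (e.symm q) a).2)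
  q₀ := e (read ⟨[], Nat.zero_le m⟩)
  qhalt := e halt
  start_right q hq := next_start f fun h => hq (by rw [← h, e.apply_symm_apply])
  start_only q a ha := next_ne_start f _ ha
  halt_stay a := by simp [next]
  halt_unique q h := by
    by_contra hq
    -- The end mark separates the states: every other state moves right on it, the halt state stays.
    have h1 := next_start f fun h => hq (by rw [← h, e.apply_symm_apply])
    have h2 := congrArg Prod.snd (h Sym.start)
    rw [e.symm_apply_apply] at h2
    have h3 : (Sym.start, Move.right) = (Sym.start, Move.stay) := h1.symm.trans h2
    simp at h3

section

variable {m n : ℕ} (e : PrefixState m ≃ Fin n) (f : List Bool → Bool) (s : List Bool)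

/-- A step of the prefix machine that does not change the tape. -/
theorem prefixMachine_step (q q' : PrefixState m) (p p' : ℕ) (T : ℕ → Sym) (μ : Move)
    (h : next f q (T p) = (q', T p, μ))
    (hp : p' = match μ with
      | Move.left => p - 1
      | Move.stay => p
      | Move.right => p + 1) :
    (prefixMachine e f).step ⟨e q, p, T⟩ = ⟨e q', p', T⟩ := by
  have hδ : (prefixMachine e f).δ (e q) (T p) = (e q', T p, μ) := by
    change (e (next f (e.symm (e q)) (T p)).1, (next f (e.symm (e q)) (T p)).2) = _
    rw [e.symm_apply_apply, h]
  subst hp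
  simp only [step, hδ, Function.update_eq_self]
  cases μ <;> rfl

theorem init_tape_succ (F : TM) (j : ℕ) :
    (F.init s).tape (j + 1) = match s[j]? with
      | some b => Sym.ofBool b
      | none => Sym.blank := rfl

/-- This lets the returning head recognise square `0`. -/
theorem init_tape_succ_ne_start (F : TM) (j : ℕ) : (F.init s).tape (j + 1) ≠ Sym.start := by
  rw [init_tape_succ]
  cases s[j]? with
  | none => simp
  | some b => cases b <;> simp [Sym.ofBool]

theorem run_succ (F : TM) (i : ℕ) : F.run s (i + 1) = F.step (F.run s i) :=
  Function.iterate_succ_apply' _ _ _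

theorem prefixMachine_run_read (k : ℕ) (hk : k ≤ m) (hs : k ≤ s.length) :
    (prefixMachine e f).run s (k + 1) =
      ⟨e (read ⟨s.take k, by simp [hk]⟩), k + 1, ((prefixMachine e f).init s).tape⟩ := by
  induction k with
  | zero => exact prefixMachine_step e f _ _ _ _ _ Move.right rfl rfl
  | succ k ih =>
    rw [run_succ, ih (by omega) (by omega)]
    refine prefixMachine_step e f _ _ _ _ _ Move.right ?_ rfl
    have hks : k < s.length := hs
    simp only [init_tape_succ, List.getElem?_eq_getElem hks]
    rw [next_ofBool, readLetter, dif_pos (by simp; omega)]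
    simp [List.take_append_getElem]

theorem prefixMachine_run_turn :
    (prefixMachine e f).run s (min m s.length + 2) =
      ⟨e (back (f (s.take m))), min m s.length, ((prefixMachine e f).init s).tape⟩ := by
  rw [run_succ, prefixMachine_run_read e f s _ (min_le_left _ _) (min_le_right _ _)]
  refine prefixMachine_step e f _ _ _ _ _ Move.left ?_ rfl
  have ht : s.take (min m s.length) = s.take m := by simp [← List.take_take]
  -- The turn is caused by a blank if the input has at most `m` letters, otherwise by the letter
  -- `s[m]`, which is seen but not stored.
  obtain h | h := le_or_gt s.length m
  · have hcell : ((prefixMachine e f).init s).tape (min m s.length + 1) = Sym.blank := by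
      rw [init_tape_succ, min_eq_right h, List.getElem?_eq_none le_rfl]
    rw [hcell, ← ht]
    rfl
  · have hcell : ((prefixMachine e f).init s).tape (min m s.length + 1) = Sym.ofBool s[m] := by
      rw [init_tape_succ, min_eq_left h.le, List.getElem?_eq_getElem h]
    rw [hcell, ← ht, next_ofBool, readLetter, dif_neg (by simp; omega)]

theorem prefixMachine_run_back (k : ℕ) (hk : k ≤ min m s.length) :
    (prefixMachine e f).run s (min m s.length + 2 + k) =
      ⟨e (back (f (s.take m))), min m s.length - k, ((prefixMachine e f).init s).tape⟩ := by
  induction k with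
  | zero => exact prefixMachine_run_turn e f s
  | succ k ih =>
    rw [← add_assoc, run_succ, ih (by omega)]
    refine prefixMachine_step e f _ _ _ _ _ Move.left (next_back f _ ?_) (by simp; omega)
    -- Fewer than `min m |s|` steps back have been made, so the head is not yet at square `0`.
    obtain ⟨j, hj⟩ : ∃ j, min m s.length - k = j + 1 := ⟨min m s.length - k - 1, by omega⟩
    rw [hj]
    exact init_tape_succ_ne_start s _ j

theorem prefixMachine_run_halt :
    (prefixMachine e f).run s (min m s.length + 2 + min m s.length + 2) =
      ⟨e halt, 1, Function.update ((prefixMachine e f).init s).tape 1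
        (Sym.ofBool (f (s.take m)))⟩ := by
  have h : (prefixMachine e f).run s (min m s.length + 2 + min m s.length + 1) =
      ⟨e (out (f (s.take m))), 1, ((prefixMachine e f).init s).tape⟩ := by
    rw [run_succ, prefixMachine_run_back e f s _ le_rfl, Nat.sub_self]
    exact prefixMachine_step e f _ _ _ _ _ Move.right rfl rfl
  rw [run_succ, h]
  have hδ : (prefixMachine e f).δ (e (out (f (s.take m))))
      (((prefixMachine e f).init s).tape 1) =
        (e halt, Sym.ofBool (f (s.take m)), Move.stay) := by
    change (e (next f (e.symm (e _)) _).1, (next f (e.symm (e _)) _).2) = _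
    rw [e.symm_apply_apply, next_out f _ (init_tape_succ_ne_start s _ 0)]
  simp only [step, hδ]

end

/-- Every function of the first `m` letters of the input is computed by a machine in bounded
time. -/
theorem exists_computes_prefix (m : ℕ) (f : List Bool → Bool) :
    ∃ (F : TM) (hF : ∀ s, F.HaltsOn s), (∀ s, F.Outputs s (f (s.take m))) ∧
      ∃ K : ℕ, ∀ n, F.timeComplexity hF n < K := by
  obtain ⟨n, ⟨e⟩⟩ := Finite.exists_equiv_fin (PrefixState m)
  have hstate : ∀ s, ((prefixMachine e f).run s
      (min m s.length + 2 + min m s.length + 2)).state = (prefixMachine e f).qhalt := fun s => by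
    rw [prefixMachine_run_halt]
    rfl
  -- The run halts by step `2 * min m |s| + 4`, which is below `2 * m + 5`.
  refine ⟨prefixMachine e f, fun s => ⟨_, hstate s⟩, fun s => ⟨_, hstate s, ?_⟩,
    2 * m + 5, fun n => ?_⟩
  · rw [prefixMachine_run_halt]
    simp
  · refine Nat.lt_succ_of_le (Finset.sup_le fun w _ => ?_)
    refine (Nat.find_min' _ (hstate (List.ofFn w))).trans ?_
    omega

end TM

end NormalProof

theorem mainTheorem5
    (M : NormalProof.TM) (b : Bool) (r : List Bool) (hM : M.Outputs r b)
    (π : List NormalProof.Fml) (hπ : NormalProof.IsNormalProof M r b π)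
    (G : List NormalProof.Checker)
    (hG : NormalProof.IsCheckSeq (NormalProof.theoryAL M r) π G) :
    -- a Turing machine computes `s ↦ CK_π(⟨T_{M,s}, AL⟩, π)` in bounded time
    (∃ (F : NormalProof.TM) (hF : ∀ s, F.HaltsOn s),
      (∀ s, F.Outputs s (NormalProof.CK G (NormalProof.theoryAL M s) π)) ∧
      ∃ K : ℕ, ∀ s : List Bool, F.timeComplexity hF s.length < K) ∧
    -- the checkers that are not of type `G_IN` return `1` whatever `s` is
    (∀ i g, G[i]? = some g → g ≠ NormalProof.Checker.member →
      ∀ s, g.run (NormalProof.theoryAL M s) π i = true) ∧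
    -- a checker of type `G_IN` needs no more than the first `|T_{M,r}|` members of `T_{M,s}`
    (∀ i φ, G[i]? = some NormalProof.Checker.member → π[i]? = some φ →
      ∀ s, NormalProof.Checker.member.run (NormalProof.theoryAL M s) π i =
        NormalProof.AL φ
          ((NormalProof.theoryMS M s).take (NormalProof.theoryMS M r).length)) := by
  refine ⟨?_, fun i g hi hg s =>
    NormalProof.Checker.run_eq_true_of_ne_member hg _ (hG.2 i g hi), fun i φ hi hφ s => ?_⟩
  · obtain ⟨F, hF, hout, K, hK⟩ := NormalProof.TM.exists_computes_prefix (r.length + 1)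
      fun s => NormalProof.CK G (NormalProof.theoryAL M s) π
    refine ⟨F, hF, fun s => ?_, K, fun s => hK _⟩
    -- The machine evaluates the checker on the truncated input, which gives the same value.
    rw [← NormalProof.CK_take_input M r s π G hG]
    exact hout s
  · obtain ⟨ψ, hψ, hr⟩ := hG.2 i _ hi
    obtain rfl : φ = ψ := Option.some.inj (hφ.symm.trans hψ)
    rw [NormalProof.Checker.run_member M s hφ, Bool.eq_iff_iff, NormalProof.AL_correct,
      NormalProof.AL_correct]
    exact NormalProof.mem_theoryMS_iff_mem_take M r s φ hr
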